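/- Let $X_1,X_2,\dots$ be i.i.d. real random variables with distribution $G_0$ (for instance, one with a $k$-monotone density), let $\mathbb G_n$ be the empirical distribution of $X_1,\dots,X_n$, and write $(\mathbb G_n-G_0)(g)=\frac1n\sum_{i=1}^n g(X_i)-\int g\,dG_0$. Let $k\ge 1$ be an integer, $d\ge 1/2$, $x_0\in\mathbb R$, $\delta>0$, and let $\mathcal F$ be a collection of measurable real functions on $[x_0-\delta,x_0+\delta]$. Fix $x\in[x_0-\delta,x_0+\delta)$ and $R_0>0$. For each $R$ with $0<R\le R_0$ and $[x,x+R]\subseteq[x_0-\delta,x_0+\delta]$ (an admissible $R$) let $$\mathcal F_{x,R}=\{f_{x,y}:=f\,1_{[x,y]}\;:\;f\in\mathcal F,\ x\le y\le x+R\}$$ (functions on $\mathbb R$ vanishing off $[x,y]$), and suppose that $\mathcal F_{x,R}$ is $G_0$-measurable, i.e. for all $n$ and $e\in\mathbb R^n$ the map $(t_1,\dots,t_n)\mapsto\sup_{g\in\mathcal F_{x,R}}|\sum_i e_i g(t_i)|$ is measurable with respect to the completion of $G_0^{n}$. Suppose that each $\mathcal F_{x,R}$ with $R$ admissible has a measurable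 real-valued envelope $F_{x,R}$ (that is, $|g|\le F_{x,R}$ pointwise for all $g\in\mathcal F_{x,R}$) such that, with a constant $K>0$ that does not depend on $R$, $$E\,F_{x,R}^2(X_1)\le K R^{2d-1},$$ and such that $$\sup_{R}\ \sup_Q\int_0^1\sqrt{\log N\big(\eta\|F_{x,R}\|_{Q,2},\mathcal F_{x,R},L_2(Q)\big)}\,d\eta<\infty ,$$ where the first supremum is over all admissible $R$, the second over all finitely discrete probability measures $Q$ on $\mathbb R$ with $\|F_{x,R}\|_{Q,2}>0$, and $N(r,\mathcal G,L_2(Q))$ is the minimal number of open $L_2(Q)$-balls of radius $r$, with centres in $L_2(Q)$ but not necessarily in $\mathcal G$, needed to cover $\mathcal G$. Then for every $\varepsilon>0$ there are random variables $M_n=O_p(1)$ such that for all $n\ge1$, all $f\in\mathcal F$ and all $y\in[x,x_0+\delta]$ with $|y-x|\le R_0$, $$|(\mathbb G_n-G_0)(f_{x,y})|\le\varepsilon|y-x|^{k+d}+n^{-(k+d)/(2k+1)}M_n .$$ -/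

import Mathlib

open MeasureTheory ProbabilityTheory Set
open scoped ENNReal NNReal

noncomputable section

/-- The localized class of all `f_{x,y} = f * 1_{[x,y]}` with `f` in `𝓕` and `x ≤ y ≤ x + R`,
regarded as functions on the whole line that vanish off `[x,y]`. -/
def localizedClass (𝓕 : Set (ℝ → ℝ)) (x R : ℝ) : Set (ℝ → ℝ) :=
  {g | ∃ f ∈ 𝓕, ∃ y ∈ Icc x (x + R), g = (Icc x y).indicator f}

/-- The scales `0 < R ≤ R₀` for which `[x, x + R]` lies inside `[x₀ - δ, x₀ + δ]`. -/
def admissibleScales (x₀ δ R₀ x : ℝ) : Set ℝ :=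
  {R | 0 < R ∧ R ≤ R₀ ∧ Icc x (x + R) ⊆ Icc (x₀ - δ) (x₀ + δ)}

/-- `F` is a (measurable, real-valued) envelope function of the class `𝒢`. -/
def IsEnvelope (F : ℝ → ℝ) (𝒢 : Set (ℝ → ℝ)) : Prop :=
  Measurable F ∧ ∀ g ∈ 𝒢, ∀ t, |g t| ≤ F t

/-- The covering number `N(r, 𝒢, L₂(Q))`: the least number of open `L₂(Q)`-balls of radius `r`
that cover `𝒢`. The centres have finite `L₂(Q)` norm and need not belong to `𝒢`.
It is `⊤` if no finite cover exists. -/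
def l2CoveringNumber (r : ℝ≥0∞) (𝒢 : Set (ℝ → ℝ)) (Q : Measure ℝ) : ℕ∞ :=
  ⨅ (t : Finset (ℝ → ℝ)) (_ : (∀ c ∈ t, MemLp c 2 Q) ∧
    ∀ g ∈ 𝒢, ∃ c ∈ t, eLpNorm (g - c) 2 Q < r), (t.card : ℕ∞)

/-- `√(log N)` as an extended nonnegative number, equal to `∞` for `N = ∞`. -/
def sqrtLog (N : ℕ∞) : ℝ≥0∞ :=
  (ENNReal.log (N : ℝ≥0∞)).toENNReal ^ (1 / 2 : ℝ)

/-- `Q` is carried by finitely many points. -/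
def IsFinitelyDiscrete (Q : Measure ℝ) : Prop :=
  ∃ s : Finset ℝ, Q (s : Set ℝ)ᶜ = 0

/-- The entropy integral `∫₀¹ √(log N(η ‖F‖_{Q,2}, 𝒢, L₂(Q))) dη`. -/
def entropyIntegral (𝒢 : Set (ℝ → ℝ)) (F : ℝ → ℝ) (Q : Measure ℝ) : ℝ≥0∞ :=
  ∫⁻ η in Ioc (0 : ℝ) 1, sqrtLog (l2CoveringNumber (ENNReal.ofReal η * eLpNorm F 2 Q) 𝒢 Q)

/-- The uniform entropy integral: the supremum of the entropy integrals over all finitely discrete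
probability measures `Q` with `‖F‖_{Q,2} > 0`. -/
def uniformEntropyIntegral (𝒢 : Set (ℝ → ℝ)) (F : ℝ → ℝ) : ℝ≥0∞ :=
  ⨆ (Q : Measure ℝ) (_ : IsProbabilityMeasure Q ∧ IsFinitelyDiscrete Q ∧ 0 < eLpNorm F 2 Q),
    entropyIntegral 𝒢 F Q

/-- `𝒢` is a `G`-measurable class: for all `n` and `e ∈ ℝⁿ` the map
`(t₁, …, tₙ) ↦ sup_{g ∈ 𝒢} |∑ eᵢ g(tᵢ)|` is measurable for the `Gⁿ`-completion of the Borel sets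
(for functions with values in `[0, ∞]` this is the same as `AEMeasurable`). -/
def IsMeasurableClass (𝒢 : Set (ℝ → ℝ)) (G : Measure ℝ) : Prop :=
  ∀ (n : ℕ) (e : Fin n → ℝ),
    AEMeasurable (fun t : Fin n → ℝ => ⨆ g ∈ 𝒢, ENNReal.ofReal |∑ i, e i * g (t i)|)
      (Measure.pi fun _ : Fin n => G)

/-- `(𝔾ₙ - G)(g) = n⁻¹ ∑_{i < n} g(Xᵢ(ω)) - ∫ g dG`. -/
def empiricalDeviation {Ω : Type*} (X : ℕ → Ω → ℝ) (G : Measure ℝ) (n : ℕ) (ω : Ω)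
    (g : ℝ → ℝ) : ℝ :=
  (n : ℝ)⁻¹ * ∑ i ∈ Finset.range n, g (X i ω) - ∫ t, g t ∂G

/-- `Mₙ = O_p(1)` for `n ≥ 1`. -/
def IsBigOpOne {Ω : Type*} [MeasurableSpace Ω] (P : Measure Ω) (M : ℕ → Ω → ℝ) : Prop :=
  ∀ η : ℝ, 0 < η → ∃ B : ℝ, ∀ n : ℕ, 1 ≤ n → P {ω | B < |M n ω|} ≤ ENNReal.ofReal η

end

/-- The Rademacher sign attached to a Boolean. -/
def boolSign (b : Bool) : ℝ := if b then 1 else -1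

theorem abs_boolSign (b : Bool) : |boolSign b| = 1 := by
  cases b <;> simp [boolSign]

/-- The Rademacher sum `∑ sᵢ vᵢ`. -/
noncomputable def signedSum {ι : Type*} [Fintype ι] (s : ι → Bool) (v : ι → ℝ) : ℝ :=
  ∑ i, boolSign (s i) * v i

section Rademacher

variable {ι : Type*} [Fintype ι]

theorem signedSum_sub (s : ι → Bool) (v w : ι → ℝ) :
    signedSum s (v - w) = signedSum s v - signedSum s w := by
  simp [signedSum, mul_sub, Finset.sum_sub_distrib]

theorem signedSum_smul (s : ι → Bool) (c : ℝ) (v : ι → ℝ) :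
    signedSum s (c • v) = c * signedSum s v := by
  simp only [signedSum, Finset.mul_sum, Pi.smul_apply, smul_eq_mul]
  exact Finset.sum_congr rfl fun i _ => by ring

theorem abs_signedSum_le (s : ι → Bool) (v : ι → ℝ) {r : ℝ} (hr : 0 ≤ r)
    (hv : ∑ i, v i ^ 2 ≤ r ^ 2) : |signedSum s v| ≤ Fintype.card ι * r := by
  calc |signedSum s v| ≤ ∑ i, |boolSign (s i) * v i| := Finset.abs_sum_le_sum_abs _ _
    _ ≤ ∑ _i : ι, r := by
        refine Finset.sum_le_sum fun i _ => ?_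
        rw [abs_mul, abs_boolSign, one_mul]
        refine abs_le_of_sq_le_sq (le_trans ?_ hv) hr
        exact Finset.single_le_sum (f := fun i => v i ^ 2) (fun i _ => sq_nonneg _)
          (Finset.mem_univ i)
    _ = Fintype.card ι * r := by simp

variable [DecidableEq ι]

theorem sum_exp_signedSum_le (v : ι → ℝ) :
    ∑ s : ι → Bool, Real.exp (signedSum s v) ≤
      2 ^ Fintype.card ι * Real.exp ((∑ i, v i ^ 2) / 2) := by
  have h : ∑ s : ι → Bool, Real.exp (signedSum s v) =
      ∏ i, ∑ b : Bool, Real.exp (boolSign b * v i) := by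
    rw [Finset.prod_univ_sum, Fintype.piFinset_univ]
    simp [signedSum, Real.exp_sum]
  rw [h, Finset.sum_div, Real.exp_sum, ← Finset.card_univ, ← Finset.prod_const,
    ← Finset.prod_mul_distrib]
  refine Finset.prod_le_prod (fun i _ => by positivity) fun i _ => ?_
  have := Real.cosh_le_exp_half_sq (v i)
  rw [Real.cosh_eq] at this
  simp only [Fintype.sum_bool, boolSign]
  simp
  linarith

/-- Maximal inequality for Rademacher sums over a finite set of vectors. -/
theorem exists_majorant_signedSum (V : Finset (ι → ℝ)) {L b : ℝ} (hL : 0 < L) (hb : 1 ≤ b)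
    (hV : ∀ v ∈ V, ∑ i, v i ^ 2 ≤ L ^ 2) (hcard : 2 * (V.card : ℝ) ≤ Real.exp (b ^ 2)) :
    ∃ Z : (ι → Bool) → ℝ, (∀ s, ∀ v ∈ V, |signedSum s v| ≤ Z s) ∧
      ∑ s, Z s ≤ 2 ^ Fintype.card ι * (3 * b * L) := by
  have hb0 : 0 < b := by linarith
  refine ⟨fun s => 2 * b * L + L / b * Real.exp (-(2 * b ^ 2)) * ∑ v ∈ V,
    (Real.exp (signedSum s ((b / L) • v)) + Real.exp (signedSum s ((-(b / L)) • v))),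
    fun s v hv => ?_, ?_⟩
  · have key : ∀ y : ℝ, y ≤ 2 * b * L + L / b * Real.exp (-(2 * b ^ 2)) * Real.exp (b / L * y) := by
      intro y
      have h1 := Real.add_one_le_exp (-(2 * b ^ 2) + b / L * y)
      rw [mul_assoc (L / b), ← Real.exp_add]
      have h2 : L / b * (-(2 * b ^ 2) + b / L * y) ≤
          L / b * Real.exp (-(2 * b ^ 2) + b / L * y) := by
        gcongr; linarith
      have h3 : L / b * (-(2 * b ^ 2) + b / L * y) = y - 2 * b * L := by
        field_simp
        ring
      linarith
    have hs : Real.exp (signedSum s ((b / L) • v)) + Real.exp (signedSum s ((-(b / L)) • v)) ≤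
        ∑ v ∈ V,
          (Real.exp (signedSum s ((b / L) • v)) + Real.exp (signedSum s ((-(b / L)) • v))) :=
      Finset.single_le_sum (f := fun v => Real.exp (signedSum s ((b / L) • v)) +
        Real.exp (signedSum s ((-(b / L)) • v))) (fun _ _ => by positivity) hv
    rw [signedSum_smul, signedSum_smul] at hs
    beta_reduce
    rw [abs_le']
    constructor
    · refine (key _).trans ?_
      gcongr
      refine le_trans ?_ hs
      linarith [Real.exp_pos (-(b / L) * signedSum s v)]
    · refine (key _).trans ?_
      gcongr
      refine le_trans ?_ hs
      rw [mul_neg, neg_mul]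
      linarith [Real.exp_pos (b / L * signedSum s v)]
  · have hexp : ∀ c : ℝ, c ^ 2 = (b / L) ^ 2 → ∀ v ∈ V,
        ∑ s : ι → Bool, Real.exp (signedSum s (c • v)) ≤
          2 ^ Fintype.card ι * Real.exp (b ^ 2 / 2) := by
      intro c hc v hv
      refine (sum_exp_signedSum_le _).trans ?_
      gcongr
      simp only [Pi.smul_apply, smul_eq_mul, mul_pow, ← Finset.mul_sum, hc]
      calc (b / L) ^ 2 * ∑ i, v i ^ 2 ≤ (b / L) ^ 2 * L ^ 2 := by gcongr; exact hV v hv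
        _ = b ^ 2 := by field_simp
    have h5 : ∑ _s : ι → Bool, 2 * b * L = 2 ^ Fintype.card ι * (2 * b * L) := by simp
    rw [Finset.sum_add_distrib, h5, ← Finset.mul_sum, Finset.sum_comm]
    have h1 : ∑ v ∈ V, ∑ s : ι → Bool, (Real.exp (signedSum s ((b / L) • v)) +
        Real.exp (signedSum s ((-(b / L)) • v))) ≤
        ∑ v ∈ V, 2 * (2 ^ Fintype.card ι * Real.exp (b ^ 2 / 2)) := by
      refine Finset.sum_le_sum fun v hv => ?_
      rw [Finset.sum_add_distrib, two_mul]
      exact add_le_add (hexp _ rfl v hv) (hexp _ (by ring) v hv)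
    rw [Finset.sum_const, nsmul_eq_mul] at h1
    have h2 : ∑ v ∈ V, ∑ s : ι → Bool, (Real.exp (signedSum s ((b / L) • v)) +
        Real.exp (signedSum s ((-(b / L)) • v))) ≤
        2 ^ Fintype.card ι * (Real.exp (b ^ 2) * Real.exp (b ^ 2 / 2)) := by
      refine h1.trans ?_
      calc _ = 2 ^ Fintype.card ι * ((2 * V.card) * Real.exp (b ^ 2 / 2)) := by ring
        _ ≤ _ := by gcongr
    have h3 : L / b * Real.exp (-(2 * b ^ 2)) * (2 ^ Fintype.card ι *
        (Real.exp (b ^ 2) * Real.exp (b ^ 2 / 2))) ≤ 2 ^ Fintype.card ι * (b * L) := by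
      have : Real.exp (-(2 * b ^ 2)) * (Real.exp (b ^ 2) * Real.exp (b ^ 2 / 2)) ≤ 1 := by
        rw [← Real.exp_add, ← Real.exp_add, Real.exp_le_one_iff]
        nlinarith
      calc _ = 2 ^ Fintype.card ι * (L / b * (Real.exp (-(2 * b ^ 2)) *
              (Real.exp (b ^ 2) * Real.exp (b ^ 2 / 2)))) := by ring
        _ ≤ 2 ^ Fintype.card ι * (b * L) := by
          refine mul_le_mul_of_nonneg_left ?_ (by positivity)
          have : L / b ≤ b * L := by
            rw [div_le_iff₀ hb0]; nlinarith [mul_le_mul hb hb zero_le_one hb0.le]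
          calc _ ≤ L / b * 1 := by gcongr
            _ ≤ _ := by linarith
    have h4 : L / b * Real.exp (-(2 * b ^ 2)) * ∑ v ∈ V, ∑ s : ι → Bool,
        (Real.exp (signedSum s ((b / L) • v)) + Real.exp (signedSum s ((-(b / L)) • v))) ≤
        2 ^ Fintype.card ι * (b * L) := le_trans (by gcongr) h3
    linarith

/-- One link of a chain: the increments between two nets of comparable size. -/
theorem exists_majorant_signedSum_link {α : Type*} (T : Set α) (t : Finset (ι → ℝ))
    (t' : Finset (ι → ℝ)) (p p' : α → ι → ℝ) (hp : ∀ g ∈ T, p g ∈ t) (hp' : ∀ g ∈ T, p' g ∈ t')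
    {L a : ℝ} (hL : 0 < L) (ha : 0 ≤ a) (ht : (t.card : ℝ) ≤ Real.exp (a ^ 2))
    (ht' : (t'.card : ℝ) ≤ Real.exp (a ^ 2))
    (hd : ∀ g ∈ T, ∑ i, (p g i - p' g i) ^ 2 ≤ L ^ 2) :
    ∃ Z : (ι → Bool) → ℝ, (∀ s, ∀ g ∈ T, |signedSum s (p g - p' g)| ≤ Z s) ∧
      ∑ s, Z s ≤ 2 ^ Fintype.card ι * (3 * (1 + 2 * a) * L) := by
  classical
  obtain ⟨Z, hZ, hZs⟩ := exists_majorant_signedSum (b := 1 + 2 * a)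
    (((t ×ˢ t').image fun q => q.1 - q.2).filter fun v => ∑ i, v i ^ 2 ≤ L ^ 2) hL (by linarith)
    (fun v hv => (Finset.mem_filter.1 hv).2) (by
      have h1 : (((((t ×ˢ t').image fun q => q.1 - q.2).filter
          fun v => ∑ i, v i ^ 2 ≤ L ^ 2).card : ℕ) : ℝ) ≤ t.card * t'.card := by
        rw [← Nat.cast_mul, ← Finset.card_product]
        exact_mod_cast (Finset.card_filter_le _ _).trans Finset.card_image_le
      have h2 : (2 : ℝ) ≤ Real.exp 1 := by linarith [Real.add_one_le_exp (1 : ℝ)]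
      calc _ ≤ Real.exp 1 * (Real.exp (a ^ 2) * Real.exp (a ^ 2)) := by
            refine mul_le_mul h2 (h1.trans ?_) (by positivity) (by positivity)
            gcongr
        _ ≤ Real.exp ((1 + 2 * a) ^ 2) := by
            rw [← Real.exp_add, ← Real.exp_add, Real.exp_le_exp]
            nlinarith)
  refine ⟨Z, fun s g hg => hZ s _ ?_, hZs⟩
  refine Finset.mem_filter.2 ⟨Finset.mem_image.2 ⟨(p g, p' g), ?_, rfl⟩, hd g hg⟩
  exact Finset.mem_product.2 ⟨hp g hg, hp' g hg⟩

/-- Chaining for Rademacher sums: a dyadic sequence of nets bounds the mean of the supremum. -/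
theorem sum_iSup_signedSum_le (T : Set (ι → ℝ)) {σ A : ℝ} (hσ : 0 < σ)
    (hT : ∀ g ∈ T, ∑ i, g i ^ 2 ≤ σ ^ 2) (a : ℕ → ℝ) (ha : ∀ q, 0 ≤ a q) (hmono : Monotone a)
    (t : ℕ → Finset (ι → ℝ)) (hcard : ∀ q, ((t q).card : ℝ) ≤ Real.exp (a q ^ 2))
    (hcover : ∀ q, ∀ g ∈ T, ∃ c ∈ t q, ∑ i, (g i - c i) ^ 2 ≤ (σ * (1 / 2) ^ q) ^ 2)
    (hA : ∀ m, ∑ q ∈ Finset.range m, (1 / 2) ^ q * a q ≤ A) :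
    ∑ s : ι → Bool, ⨆ g ∈ T, ENNReal.ofReal |signedSum s g| ≤
      2 ^ Fintype.card ι * ENNReal.ofReal (24 * σ * (1 + A)) := by
  have hcov' : ∀ q, ∀ g : ι → ℝ, ∃ c : ι → ℝ, g ∈ T → c ∈ t q ∧
      ∑ i, (g i - c i) ^ 2 ≤ (σ * (1 / 2) ^ q) ^ 2 := by
    intro q g
    by_cases hg : g ∈ T
    · obtain ⟨c, hc⟩ := hcover q g hg
      exact ⟨c, fun _ => hc⟩
    · exact ⟨0, fun h => absurd h hg⟩
  choose p hp using hcov'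
  have chain : ∀ m, ∃ Z : (ι → Bool) → ℝ, (∀ s, ∀ g ∈ T, |signedSum s (p m g)| ≤ Z s) ∧
      ∑ s, Z s ≤ 2 ^ Fintype.card ι *
        ∑ q ∈ Finset.range (m + 1), 12 * σ * ((1 / 2) ^ q * (1 + 2 * a q)) := by
    intro m
    induction m with
    | zero =>
      obtain ⟨Z, hZ, hZs⟩ := exists_majorant_signedSum_link T (t 0) {0} (p 0) (fun _ => 0)
        (fun g hg => (hp 0 g hg).1) (fun g _ => Finset.mem_singleton_self _)
        (L := 4 * σ) (by positivity) (ha 0) (hcard 0)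
        (by simpa using sq_nonneg (a 0)) (fun g hg => by
          have h1 := (hp 0 g hg).2
          have h2 := hT g hg
          have h3 : ∀ i, p 0 g i ^ 2 ≤ 2 * g i ^ 2 + 2 * (g i - p 0 g i) ^ 2 := fun i => by
            nlinarith [sq_nonneg (2 * g i - p 0 g i)]
          simp only [Pi.zero_apply, sub_zero]
          refine (Finset.sum_le_sum fun i _ => h3 i).trans ?_
          rw [Finset.sum_add_distrib, ← Finset.mul_sum, ← Finset.mul_sum]
          simp only [pow_zero, mul_one] at h1
          nlinarith)
      refine ⟨Z, fun s g hg => by simpa using hZ s g hg, hZs.trans (le_of_eq ?_)⟩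
      simp
      ring
    | succ m ih =>
      obtain ⟨Z₁, hZ₁, hZs₁⟩ := ih
      obtain ⟨Z, hZ, hZs⟩ := exists_majorant_signedSum_link T (t (m + 1)) (t m) (p (m + 1)) (p m)
        (fun g hg => (hp _ g hg).1) (fun g hg => (hp _ g hg).1)
        (L := 4 * (σ * (1 / 2) ^ (m + 1))) (by positivity) (ha (m + 1)) (hcard (m + 1))
        ((hcard m).trans (by
          gcongr
          · exact ha m
          · exact hmono m.le_succ)) (fun g hg => by
          have h1 := (hp m g hg).2
          have h2 := (hp (m + 1) g hg).2
          have h3 : ∀ i, (p (m + 1) g i - p m g i) ^ 2 ≤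
              2 * (g i - p m g i) ^ 2 + 2 * (g i - p (m + 1) g i) ^ 2 := fun i => by
            nlinarith [sq_nonneg ((g i - p m g i) + (g i - p (m + 1) g i))]
          refine (Finset.sum_le_sum fun i _ => h3 i).trans ?_
          rw [Finset.sum_add_distrib, ← Finset.mul_sum, ← Finset.mul_sum]
          have h4 : σ * (1 / 2) ^ m = 2 * (σ * (1 / 2) ^ (m + 1)) := by ring
          rw [h4] at h1
          nlinarith [sq_nonneg (σ * (1 / 2) ^ (m + 1))])
      refine ⟨fun s => Z₁ s + Z s, fun s g hg => ?_, ?_⟩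
      · have h1 := hZ₁ s g hg
        have h2 := hZ s g hg
        rw [signedSum_sub] at h2
        have := abs_add_le (signedSum s (p m g)) (signedSum s (p (m + 1) g) - signedSum s (p m g))
        rw [add_sub_cancel] at this
        linarith
      · rw [Finset.sum_add_distrib, Finset.sum_range_succ _ (m + 1), mul_add]
        refine add_le_add hZs₁ (hZs.trans (le_of_eq ?_))
        ring
  have hgeom : ∀ m : ℕ, ∑ q ∈ Finset.range m, (1 / 2 : ℝ) ^ q ≤ 2 := by
    intro m
    rw [geom_sum_eq (by norm_num)]
    have h1 : (0 : ℝ) ≤ (1 / 2) ^ m := by positivity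
    have h2 : ((1 / 2 : ℝ) ^ m - 1) / (1 / 2 - 1) = 2 - 2 * (1 / 2) ^ m := by ring
    linarith
  have hbound : ∀ m : ℕ, ∑ s : ι → Bool, ⨆ g ∈ T, ENNReal.ofReal |signedSum s g| ≤
      ENNReal.ofReal (2 ^ Fintype.card ι *
        (24 * σ * (1 + A) + Fintype.card ι * (σ * (1 / 2) ^ m))) := by
    intro m
    obtain ⟨Z, hZ, hZs⟩ := chain m
    have h1 : ∀ s : ι → Bool, ⨆ g ∈ T, ENNReal.ofReal |signedSum s g| ≤
        ENNReal.ofReal (max 0 (Z s + Fintype.card ι * (σ * (1 / 2) ^ m))) := by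
      intro s
      refine iSup₂_le fun g hg => ENNReal.ofReal_le_ofReal (le_max_of_le_right ?_)
      have h2 := abs_signedSum_le s (g - p m g) (by positivity) (hp m g hg).2
      rw [signedSum_sub] at h2
      have := abs_add_le (signedSum s (p m g)) (signedSum s g - signedSum s (p m g))
      rw [add_sub_cancel] at this
      linarith [hZ s g hg]
    rcases T.eq_empty_or_nonempty with rfl | ⟨g₀, hg₀⟩
    · simp
    have hZ0 : ∀ s, 0 ≤ Z s := fun s => (abs_nonneg _).trans (hZ s g₀ hg₀)
    refine (Finset.sum_le_sum fun s _ => h1 s).trans ?_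
    rw [← ENNReal.ofReal_sum_of_nonneg fun s _ => le_max_left _ _]
    refine ENNReal.ofReal_le_ofReal ?_
    have h3 : ∀ s, max 0 (Z s + Fintype.card ι * (σ * (1 / 2) ^ m)) =
        Z s + Fintype.card ι * (σ * (1 / 2) ^ m) := fun s =>
      max_eq_right (add_nonneg (hZ0 s) (by positivity))
    simp only [h3]
    rw [Finset.sum_add_distrib]
    have h4 : ∑ _s : ι → Bool, (Fintype.card ι : ℝ) * (σ * (1 / 2) ^ m) =
      2 ^ Fintype.card ι * (Fintype.card ι * (σ * (1 / 2) ^ m)) := by simp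
    rw [h4, mul_add]
    gcongr
    refine hZs.trans ?_
    gcongr
    have h5 : ∑ q ∈ Finset.range (m + 1), 12 * σ * ((1 / 2) ^ q * (1 + 2 * a q)) =
        12 * σ * (∑ q ∈ Finset.range (m + 1), (1 / 2 : ℝ) ^ q +
          2 * ∑ q ∈ Finset.range (m + 1), (1 / 2) ^ q * a q) := by
      rw [← Finset.mul_sum, Finset.mul_sum _ _ (2 : ℝ), ← Finset.sum_add_distrib]
      congr 1
      exact Finset.sum_congr rfl fun q _ => by ring
    rw [h5]
    nlinarith [hgeom (m + 1), hA (m + 1)]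
  have hlim : Filter.Tendsto (fun m : ℕ => ENNReal.ofReal (2 ^ Fintype.card ι *
      (24 * σ * (1 + A) + Fintype.card ι * (σ * (1 / 2) ^ m)))) Filter.atTop
      (nhds (ENNReal.ofReal (2 ^ Fintype.card ι *
        (24 * σ * (1 + A) + Fintype.card ι * (σ * 0))))) := by
    refine ENNReal.tendsto_ofReal (Filter.Tendsto.const_mul _ (Filter.Tendsto.const_add _
      (Filter.Tendsto.const_mul _ (Filter.Tendsto.const_mul _ ?_))))
    exact tendsto_pow_atTop_nhds_zero_of_lt_one (by norm_num) (by norm_num)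
  refine (ge_of_tendsto' hlim hbound).trans (le_of_eq ?_)
  rw [mul_zero, mul_zero, add_zero, ENNReal.ofReal_mul (by positivity),
    ENNReal.ofReal_pow (by norm_num)]
  simp

end Rademacher

section Covering

theorem sqrtLog_mono : Monotone sqrtLog := by
  intro a b hab
  unfold sqrtLog
  gcongr
  exact EReal.toENNReal_le_toENNReal (ENNReal.log_monotone (by exact_mod_cast hab))

theorem sqrtLog_top : sqrtLog ⊤ = ∞ := by
  simp [sqrtLog]

theorem natCast_le_exp_sqrtLog_sq (m : ℕ) :
    (m : ℝ) ≤ Real.exp ((sqrtLog (m : ℕ∞)).toReal ^ 2) := by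
  rcases Nat.eq_zero_or_pos m with rfl | hm
  · simp [Real.exp_nonneg]
  have hm' : (0 : ℝ) < m := by exact_mod_cast hm
  have h1 : (1 : ℝ) ≤ m := by exact_mod_cast hm
  have h : (sqrtLog (m : ℕ∞)).toReal ^ 2 = Real.log m := by
    have hl : ENNReal.log ((m : ℕ∞) : ℝ≥0∞) = (Real.log m : EReal) := by
      rw [← ENNReal.log_ofReal_of_pos hm']
      simp
    rw [sqrtLog, hl, EReal.toENNReal_of_ne_top (EReal.coe_ne_top _), EReal.toReal_coe,
      ← ENNReal.toReal_rpow, ENNReal.toReal_ofReal (Real.log_nonneg h1), ← Real.sqrt_eq_rpow,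
      Real.sq_sqrt (Real.log_nonneg h1)]
  rw [h, Real.exp_log hm']

theorem l2CoveringNumber_anti {r r' : ℝ≥0∞} (h : r ≤ r') (𝒢 : Set (ℝ → ℝ)) (Q : Measure ℝ) :
    l2CoveringNumber r' 𝒢 Q ≤ l2CoveringNumber r 𝒢 Q := by
  unfold l2CoveringNumber
  refine le_iInf₂ fun t ht => iInf₂_le_of_le t ⟨ht.1, fun g hg => ?_⟩ le_rfl
  obtain ⟨c, hc, hgc⟩ := ht.2 g hg
  exact ⟨c, hc, hgc.trans_le h⟩

theorem exists_net_of_l2CoveringNumber_ne_top {r : ℝ≥0∞} {𝒢 : Set (ℝ → ℝ)} {Q : Measure ℝ}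
    (h : l2CoveringNumber r 𝒢 Q ≠ ⊤) :
    ∃ t : Finset (ℝ → ℝ), (t.card : ℕ∞) ≤ l2CoveringNumber r 𝒢 Q ∧
      ∀ g ∈ 𝒢, ∃ c ∈ t, eLpNorm (g - c) 2 Q < r := by
  have h1 : l2CoveringNumber r 𝒢 Q < l2CoveringNumber r 𝒢 Q + 1 :=
    (ENat.lt_add_one_iff h).2 le_rfl
  nth_rewrite 1 [l2CoveringNumber] at h1
  simp only [iInf_lt_iff] at h1
  obtain ⟨t, ht, hcard⟩ := h1
  exact ⟨t, (ENat.lt_add_one_iff h).1 hcard, ht.2⟩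

theorem sum_dyadic_le_lintegral {h : ℝ → ℝ≥0∞}
    (hanti : ∀ a b : ℝ, 0 < a → a ≤ b → h b ≤ h a) (m : ℕ) :
    ∑ q ∈ Finset.range m, ENNReal.ofReal ((1 / 2) ^ (q + 1)) * h ((1 / 2) ^ q) ≤
      ∫⁻ η in Ioc (0 : ℝ) 1, h η := by
  suffices H : ∑ q ∈ Finset.range m, ENNReal.ofReal ((1 / 2) ^ (q + 1)) * h ((1 / 2) ^ q) ≤
      ∫⁻ η in Ioc ((1 / 2 : ℝ) ^ m) 1, h η from
    H.trans (lintegral_mono_set (Ioc_subset_Ioc_left (by positivity)))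
  induction m with
  | zero => simp
  | succ m ih =>
    have h1 : (1 / 2 : ℝ) ^ (m + 1) ≤ (1 / 2) ^ m :=
      pow_le_pow_of_le_one (by norm_num) (by norm_num) m.le_succ
    have h2 : (1 / 2 : ℝ) ^ m ≤ 1 := pow_le_one₀ (by norm_num) (by norm_num)
    rw [← Ioc_union_Ioc_eq_Ioc h1 h2, lintegral_union measurableSet_Ioc
      (Set.Ioc_disjoint_Ioc_of_le le_rfl), Finset.sum_range_succ, add_comm]
    refine add_le_add ?_ ih
    calc ENNReal.ofReal ((1 / 2) ^ (m + 1)) * h ((1 / 2) ^ m)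
        = ∫⁻ _η in Ioc ((1 / 2 : ℝ) ^ (m + 1)) ((1 / 2) ^ m), h ((1 / 2) ^ m) := by
          rw [setLIntegral_const, Real.volume_Ioc, mul_comm]
          congr 2
          ring
      _ ≤ _ := setLIntegral_mono' measurableSet_Ioc fun η hη =>
          hanti _ _ (lt_trans (by positivity) hη.1) hη.2

end Covering

section EmpiricalMeasure

/-- The uniform distribution on the points `x₁, …, xₙ`. -/
noncomputable def uniformOnPoints {n : ℕ} (x : Fin n → ℝ) : Measure ℝ :=
  (n : ℝ≥0∞)⁻¹ • ∑ i, Measure.dirac (x i)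

variable {n : ℕ}

theorem isProbabilityMeasure_uniformOnPoints (hn : n ≠ 0) (x : Fin n → ℝ) :
    IsProbabilityMeasure (uniformOnPoints x) := by
  constructor
  simp only [uniformOnPoints, Measure.smul_apply, Measure.finsetSum_apply, measure_univ,
    smul_eq_mul]
  simp [ENNReal.inv_mul_cancel, hn]

theorem isFinitelyDiscrete_uniformOnPoints (x : Fin n → ℝ) :
    IsFinitelyDiscrete (uniformOnPoints x) := by
  classical
  refine ⟨Finset.univ.image x, ?_⟩
  simp [uniformOnPoints, Measure.finsetSum_apply]

theorem eLpNorm_uniformOnPoints (hn : n ≠ 0) (x : Fin n → ℝ) (h : ℝ → ℝ) :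
    eLpNorm h 2 (uniformOnPoints x) = ENNReal.ofReal √((n : ℝ)⁻¹ * ∑ i, h (x i) ^ 2) := by
  have hn' : (0 : ℝ) < n := by positivity
  rw [eLpNorm_eq_lintegral_rpow_enorm_toReal (by norm_num) (by norm_num), uniformOnPoints,
    lintegral_smul_measure, lintegral_finsetSum_measure, Real.sqrt_eq_rpow,
    ← ENNReal.ofReal_rpow_of_nonneg (by positivity) (by norm_num),
    ENNReal.ofReal_mul (by positivity), ENNReal.ofReal_inv_of_pos hn', ENNReal.ofReal_natCast,
    ENNReal.ofReal_sum_of_nonneg fun i _ => sq_nonneg _]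
  simp only [lintegral_dirac, smul_eq_mul, ENNReal.toReal_ofNat]
  congr 3
  funext i
  rw [← ofReal_norm, ENNReal.ofReal_rpow_of_nonneg (norm_nonneg _) (by norm_num)]
  simp

/-- Dudley's entropy bound for the Rademacher sums over a class with an envelope. -/
theorem sum_iSup_signedSum_comp_le (hn : n ≠ 0) (x : Fin n → ℝ) {𝒢 : Set (ℝ → ℝ)} {F : ℝ → ℝ}
    (hF : ∀ g ∈ 𝒢, ∀ t, |g t| ≤ F t) {J : ℝ} (hJ : 0 ≤ J)
    (hent : uniformEntropyIntegral 𝒢 F ≤ ENNReal.ofReal J) :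
    ∑ s : Fin n → Bool, ⨆ g ∈ 𝒢, ENNReal.ofReal |signedSum s fun i => g (x i)| ≤
      2 ^ n * ENNReal.ofReal (24 * √(∑ i, F (x i) ^ 2) * (1 + 2 * J)) := by
  classical
  have hn' : (0 : ℝ) < n := by positivity
  set S : ℝ := ∑ i, F (x i) ^ 2 with hS
  have hS0 : 0 ≤ S := Finset.sum_nonneg fun i _ => sq_nonneg _
  have hgF : ∀ g ∈ 𝒢, ∀ t, g t ^ 2 ≤ F t ^ 2 := fun g hg t =>
    sq_le_sq' (by linarith [abs_le.1 (hF g hg t)]) (by linarith [abs_le.1 (hF g hg t)])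
  have hgS : ∀ g ∈ 𝒢, ∑ i, g (x i) ^ 2 ≤ S := fun g hg =>
    Finset.sum_le_sum fun i _ => hgF g hg _
  rcases hS0.eq_or_lt with h0 | hSpos
  · have : ∀ s : Fin n → Bool, ⨆ g ∈ 𝒢, ENNReal.ofReal |signedSum s fun i => g (x i)| = 0 := by
      intro s
      refine le_antisymm (iSup₂_le fun g hg => ?_) bot_le
      have h := abs_signedSum_le s (fun i => g (x i)) le_rfl
        ((hgS g hg).trans (by rw [← h0]; norm_num))
      simpa using h
    simp [this]
  set Q := uniformOnPoints x with hQ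
  have hQn : eLpNorm F 2 Q = ENNReal.ofReal √((n : ℝ)⁻¹ * S) := eLpNorm_uniformOnPoints hn x F
  have hτ : 0 < √((n : ℝ)⁻¹ * S) := Real.sqrt_pos.2 (by positivity)
  set h : ℝ → ℝ≥0∞ := fun η =>
    sqrtLog (l2CoveringNumber (ENNReal.ofReal η * eLpNorm F 2 Q) 𝒢 Q) with hh
  have hanti : ∀ a b : ℝ, 0 < a → a ≤ b → h b ≤ h a := fun a b _ hab =>
    sqrtLog_mono (l2CoveringNumber_anti (by gcongr) _ _)
  have hint : ∫⁻ η in Ioc (0 : ℝ) 1, h η ≤ ENNReal.ofReal J := by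
    refine le_trans ?_ hent
    exact le_iSup₂_of_le (f := fun (Q : Measure ℝ) (_ : IsProbabilityMeasure Q ∧
      IsFinitelyDiscrete Q ∧ 0 < eLpNorm F 2 Q) => entropyIntegral 𝒢 F Q) Q
      ⟨isProbabilityMeasure_uniformOnPoints hn x, isFinitelyDiscrete_uniformOnPoints x,
        by rw [hQn]; exact ENNReal.ofReal_pos.2 hτ⟩ le_rfl
  have hdy : ∀ m, ∑ q ∈ Finset.range m, ENNReal.ofReal ((1 / 2) ^ (q + 1)) * h ((1 / 2) ^ q) ≤
      ENNReal.ofReal J := fun m => (sum_dyadic_le_lintegral hanti m).trans hint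
  have hfin : ∀ q : ℕ, h ((1 / 2) ^ q) ≠ ∞ := by
    intro q hq
    have h1 := hdy (q + 1)
    rw [Finset.sum_range_succ, hq, ENNReal.mul_top
      (by simp)] at h1
    simp at h1
  have hNfin : ∀ q : ℕ,
      l2CoveringNumber (ENNReal.ofReal ((1 / 2) ^ q) * eLpNorm F 2 Q) 𝒢 Q ≠ ⊤ := by
    intro q hq
    apply hfin q
    simp only [hh, hq, sqrtLog_top]
  choose t ht hcov using fun q => exists_net_of_l2CoveringNumber_ne_top (hNfin q)
  have hcardT : Fintype.card (Fin n) = n := Fintype.card_fin n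
  have main := sum_iSup_signedSum_le (ι := Fin n) ((fun (g : ℝ → ℝ) i => g (x i)) '' 𝒢)
    (σ := √S) (A := 2 * J) (Real.sqrt_pos.2 hSpos) (by
      rintro _ ⟨g, hg, rfl⟩
      rw [Real.sq_sqrt hS0]
      exact hgS g hg)
    (fun q => (h ((1 / 2) ^ q)).toReal) (fun _ => ENNReal.toReal_nonneg)
    (fun p q hpq => ENNReal.toReal_mono (hfin q) (hanti _ _ (by positivity)
      (pow_le_pow_of_le_one (by norm_num) (by norm_num) hpq)))
    (fun q => (t q).image fun (g : ℝ → ℝ) i => g (x i)) (fun q => by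
      refine (Nat.cast_le.2 Finset.card_image_le).trans
        ((natCast_le_exp_sqrtLog_sq _).trans ?_)
      gcongr
      · exact hfin q
      · exact sqrtLog_mono (ht q)) (by
      rintro q _ ⟨g, hg, rfl⟩
      obtain ⟨c, hc, hgc⟩ := hcov q g hg
      refine ⟨_, Finset.mem_image_of_mem _ hc, ?_⟩
      rw [hQn, hQ, eLpNorm_uniformOnPoints hn, ← ENNReal.ofReal_mul (by positivity),
        ENNReal.ofReal_lt_ofReal_iff (by positivity), Real.sqrt_lt' (by positivity), mul_pow,
        Real.sq_sqrt (by positivity)] at hgc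
      rw [mul_pow, Real.sq_sqrt hS0]
      have h2 : (n : ℝ)⁻¹ * ∑ i, (g - c) (x i) ^ 2 ≤ (n : ℝ)⁻¹ * (S * ((1 / 2) ^ q) ^ 2) := by
        linarith
      exact le_of_mul_le_mul_left h2 (by positivity))
    (fun m => by
      have h1 := hdy m
      have h2 : ∑ q ∈ Finset.range m, ENNReal.ofReal ((1 / 2) ^ (q + 1)) * h ((1 / 2) ^ q) =
          ENNReal.ofReal (∑ q ∈ Finset.range m,
            (1 / 2) ^ (q + 1) * (h ((1 / 2) ^ q)).toReal) := by
        rw [ENNReal.ofReal_sum_of_nonneg fun q _ => by positivity]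
        refine Finset.sum_congr rfl fun q _ => ?_
        rw [ENNReal.ofReal_mul (by positivity), ENNReal.ofReal_toReal (hfin q)]
      rw [h2, ENNReal.ofReal_le_ofReal_iff hJ] at h1
      have h3 : ∑ q ∈ Finset.range m, (1 / 2 : ℝ) ^ q * (h ((1 / 2) ^ q)).toReal =
          2 * ∑ q ∈ Finset.range m, (1 / 2) ^ (q + 1) * (h ((1 / 2) ^ q)).toReal := by
        rw [Finset.mul_sum]
        exact Finset.sum_congr rfl fun q _ => by ring
      linarith)
  rw [hcardT] at main
  simpa only [iSup_image] using main

end EmpiricalMeasure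

section Symmetrization

theorem MeasureTheory.MeasurePreserving.lintegral_comp_of_aemeasurable {α β : Type*}
    [MeasurableSpace α] [MeasurableSpace β] {μ : Measure α} {ν : Measure β} {T : α → β}
    (hT : MeasurePreserving T μ ν) {f : β → ℝ≥0∞} (hf : AEMeasurable f ν) :
    ∫⁻ a, f (T a) ∂μ = ∫⁻ b, f b ∂ν := by
  rw [← hT.map_eq] at hf ⊢
  exact (lintegral_map' hf hT.measurable.aemeasurable).symm

theorem aemeasurable_iSup_signedSum {n : ℕ} {G : Measure ℝ} {𝒢 : Set (ℝ → ℝ)}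
    (h𝒢 : IsMeasurableClass 𝒢 G) (s : Fin n → Bool) :
    AEMeasurable (fun x : Fin n → ℝ => ⨆ g ∈ 𝒢, ENNReal.ofReal |signedSum s fun i => g (x i)|)
      (Measure.pi fun _ : Fin n => G) :=
  h𝒢 n fun i => boolSign (s i)

variable {n : ℕ} (G : Measure ℝ) [IsProbabilityMeasure G]

theorem measurePreserving_finAppend :
    MeasurePreserving (fun p : (Fin n → ℝ) × (Fin n → ℝ) => Fin.append p.1 p.2)
      ((Measure.pi fun _ : Fin n => G).prod (Measure.pi fun _ : Fin n => G))
      (Measure.pi fun _ : Fin (n + n) => G) := by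
  have hm : Measurable fun p : (Fin n → ℝ) × (Fin n → ℝ) => Fin.append p.1 p.2 := by
    refine measurable_pi_lambda _ fun i => ?_
    refine Fin.addCases (fun j => ?_) (fun j => ?_) i
    · simp only [Fin.append_left]
      fun_prop
    · simp only [Fin.append_right]
      fun_prop
  refine ⟨hm, (Measure.pi_eq fun s hs => ?_).symm⟩
  rw [Measure.map_apply hm (MeasurableSet.univ_pi hs)]
  have : (fun p : (Fin n → ℝ) × (Fin n → ℝ) => Fin.append p.1 p.2) ⁻¹' (univ.pi s) =
      (univ.pi fun i => s (Fin.castAdd n i)) ×ˢ (univ.pi fun i => s (Fin.natAdd n i)) := by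
    ext p
    simp only [mem_preimage, mem_univ_pi, mem_prod, Fin.forall_fin_add, Fin.append_left,
      Fin.append_right]
  rw [this, Measure.prod_prod, Measure.pi_pi, Measure.pi_pi, Fin.prod_univ_add]

/-- Exchange the `i`-th coordinates of the two samples wherever `s i` is false. -/
def exchange (s : Fin n → Bool) (p : (Fin n → ℝ) × (Fin n → ℝ)) :
    (Fin n → ℝ) × (Fin n → ℝ) :=
  (fun i => if s i then p.1 i else p.2 i, fun i => if s i then p.2 i else p.1 i)

theorem measurePreserving_exchange (s : Fin n → Bool) :
    MeasurePreserving (exchange s)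
      ((Measure.pi fun _ : Fin n => G).prod (Measure.pi fun _ : Fin n => G))
      ((Measure.pi fun _ : Fin n => G).prod (Measure.pi fun _ : Fin n => G)) := by
  have hE := measurePreserving_arrowProdEquivProdArrow ℝ ℝ (Fin n) (fun _ => G) (fun _ => G)
  have hpi : MeasurePreserving
      (fun (q : Fin n → ℝ × ℝ) i => (if s i then id else Prod.swap : ℝ × ℝ → ℝ × ℝ) (q i))
      (Measure.pi fun _ : Fin n => G.prod G) (Measure.pi fun _ : Fin n => G.prod G) := by
    refine measurePreserving_pi (fun _ => G.prod G) (fun _ => G.prod G) fun i => ?_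
    split_ifs
    · exact MeasurePreserving.id _
    · exact Measure.measurePreserving_swap
  convert hE.comp (hpi.comp (hE.symm _)) using 1
  funext p
  refine Prod.ext (funext fun i => ?_) (funext fun i => ?_) <;>
  · by_cases h : s i <;>
    simp [exchange, h, MeasurableEquiv.arrowProdEquivProdArrow, Equiv.arrowProdEquivProdArrow]

variable {G} {𝒢 : Set (ℝ → ℝ)}

/-- `sup_{g ∈ 𝒢} |∑ g(xᵢ) - ∑ g(tᵢ)|` for two samples `x` and `t`. -/
noncomputable def sampleDiscrepancy (𝒢 : Set (ℝ → ℝ)) (p : (Fin n → ℝ) × (Fin n → ℝ)) : ℝ≥0∞ :=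
  ⨆ g ∈ 𝒢, ENNReal.ofReal |∑ i, g (p.1 i) - ∑ i, g (p.2 i)|

theorem aemeasurable_sampleDiscrepancy (h𝒢 : IsMeasurableClass 𝒢 G) :
    AEMeasurable (sampleDiscrepancy (n := n) 𝒢)
      ((Measure.pi fun _ : Fin n => G).prod (Measure.pi fun _ : Fin n => G)) := by
  have h := (h𝒢 (n + n) (Fin.append (fun _ : Fin n => 1) (fun _ : Fin n => -1))
    ).comp_quasiMeasurePreserving (measurePreserving_finAppend G).quasiMeasurePreserving
  refine h.congr (Filter.Eventually.of_forall fun p => ?_)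
  simp only [Function.comp_apply, sampleDiscrepancy, Fin.sum_univ_add, Fin.append_left,
    Fin.append_right, one_mul, neg_mul, Finset.sum_neg_distrib, ← sub_eq_add_neg]

theorem sampleDiscrepancy_exchange_le (s : Fin n → Bool) (p : (Fin n → ℝ) × (Fin n → ℝ)) :
    sampleDiscrepancy 𝒢 (exchange s p) ≤
      (⨆ g ∈ 𝒢, ENNReal.ofReal |signedSum s fun i => g (p.1 i)|) +
        ⨆ g ∈ 𝒢, ENNReal.ofReal |signedSum s fun i => g (p.2 i)| := by
  refine iSup₂_le fun g hg => ?_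
  have h : ∑ i, g ((exchange s p).1 i) - ∑ i, g ((exchange s p).2 i) =
      signedSum s (fun i => g (p.1 i)) - signedSum s fun i => g (p.2 i) := by
    simp only [signedSum, ← Finset.sum_sub_distrib]
    refine Finset.sum_congr rfl fun i _ => ?_
    by_cases hs : s i
    · simp [exchange, boolSign, hs]
    · simp [exchange, boolSign, hs]
      ring
  rw [h]
  calc _ ≤ ENNReal.ofReal (|signedSum s fun i => g (p.1 i)| + |signedSum s fun i => g (p.2 i)|) :=
        ENNReal.ofReal_le_ofReal (abs_sub _ _)
    _ = _ := ENNReal.ofReal_add (abs_nonneg _) (abs_nonneg _)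
    _ ≤ _ := add_le_add
        (le_iSup₂ (f := fun g (_ : g ∈ 𝒢) => ENNReal.ofReal |signedSum s fun i => g (p.1 i)|) g hg)
        (le_iSup₂ (f := fun g (_ : g ∈ 𝒢) => ENNReal.ofReal |signedSum s fun i => g (p.2 i)|) g hg)

theorem lintegral_sampleDiscrepancy_le_signedSum (h𝒢 : IsMeasurableClass 𝒢 G)
    (s : Fin n → Bool) :
    ∫⁻ p, sampleDiscrepancy 𝒢 p
        ∂((Measure.pi fun _ : Fin n => G).prod (Measure.pi fun _ : Fin n => G)) ≤
      2 * ∫⁻ x, ⨆ g ∈ 𝒢, ENNReal.ofReal |signedSum s fun i => g (x i)|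
        ∂(Measure.pi fun _ : Fin n => G) := by
  set μ := Measure.pi fun _ : Fin n => G with hμ
  have hS := aemeasurable_iSup_signedSum h𝒢 s
  have hT := measurePreserving_exchange G s
  have h1 : ∫⁻ p, sampleDiscrepancy 𝒢 p ∂(μ.prod μ) =
      ∫⁻ p, sampleDiscrepancy 𝒢 (exchange s p) ∂(μ.prod μ) :=
    (hT.lintegral_comp_of_aemeasurable (aemeasurable_sampleDiscrepancy h𝒢)).symm
  rw [h1]
  refine (lintegral_mono fun p => sampleDiscrepancy_exchange_le s p).trans ?_
  have hfst : MeasurePreserving Prod.fst (μ.prod μ) μ := measurePreserving_fst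
  have hsnd : MeasurePreserving Prod.snd (μ.prod μ) μ := measurePreserving_snd
  have hS₁ : AEMeasurable (fun p : (Fin n → ℝ) × (Fin n → ℝ) =>
      ⨆ g ∈ 𝒢, ENNReal.ofReal |signedSum s fun i => g (p.1 i)|) (μ.prod μ) :=
    hS.comp_quasiMeasurePreserving hfst.quasiMeasurePreserving
  rw [lintegral_add_left' hS₁, two_mul]
  have h₁ := hfst.lintegral_comp_of_aemeasurable hS
  have h₂ := hsnd.lintegral_comp_of_aemeasurable hS
  exact (congrArg₂ _ h₁ h₂).le

theorem lintegral_sqrt_sum_sq_le {F : ℝ → ℝ} (hF : Measurable F) {v : ℝ} (hv : 0 < v)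
    (hFv : ∫⁻ t, ENNReal.ofReal (F t ^ 2) ∂G ≤ ENNReal.ofReal v) (hn : n ≠ 0) :
    ∫⁻ x : Fin n → ℝ, ENNReal.ofReal √(∑ i, F (x i) ^ 2) ∂(Measure.pi fun _ : Fin n => G) ≤
      ENNReal.ofReal √(n * v) := by
  set μ := Measure.pi fun _ : Fin n => G with hμ
  have hn' : (0 : ℝ) < n := by positivity
  set w := √(n * v) with hw
  have hw0 : 0 < w := Real.sqrt_pos.2 (by positivity)
  have hw2 : w ^ 2 = n * v := Real.sq_sqrt (by positivity)
  have h1 : ∀ x : Fin n → ℝ, ENNReal.ofReal √(∑ i, F (x i) ^ 2) ≤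
      ENNReal.ofReal (1 / (2 * w)) * ∑ i, ENNReal.ofReal (F (x i) ^ 2) +
        ENNReal.ofReal (w / 2) := by
    intro x
    have hS0 : 0 ≤ ∑ i, F (x i) ^ 2 := Finset.sum_nonneg fun i _ => sq_nonneg _
    rw [← ENNReal.ofReal_sum_of_nonneg fun i _ => sq_nonneg _,
      ← ENNReal.ofReal_mul (by positivity), ← ENNReal.ofReal_add (by positivity) (by positivity)]
    refine ENNReal.ofReal_le_ofReal ?_
    have h2 := Real.sq_sqrt hS0
    have h3 : 1 / (2 * w) * ∑ i, F (x i) ^ 2 + w / 2 = (∑ i, F (x i) ^ 2 + w ^ 2) / (2 * w) := by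
      field_simp
    rw [h3, le_div_iff₀ (by positivity)]
    nlinarith [sq_nonneg (√(∑ i, F (x i) ^ 2) - w)]
  have h4 : ∀ i : Fin n, ∫⁻ x : Fin n → ℝ, ENNReal.ofReal (F (x i) ^ 2) ∂μ ≤
      ENNReal.ofReal v := by
    intro i
    refine le_trans (le_of_eq ?_) hFv
    exact (measurePreserving_eval (fun _ : Fin n => G) i).lintegral_comp
      (f := fun t => ENNReal.ofReal (F t ^ 2)) (by fun_prop)
  calc _ ≤ ∫⁻ x : Fin n → ℝ, (ENNReal.ofReal (1 / (2 * w)) * ∑ i, ENNReal.ofReal (F (x i) ^ 2) +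
        ENNReal.ofReal (w / 2)) ∂μ := lintegral_mono h1
    _ = ENNReal.ofReal (1 / (2 * w)) * ∑ i, ∫⁻ x : Fin n → ℝ, ENNReal.ofReal (F (x i) ^ 2) ∂μ +
        ENNReal.ofReal (w / 2) := by
      rw [lintegral_add_right _ measurable_const, lintegral_const_mul _ (by fun_prop),
        lintegral_finsetSum _ (fun i _ => by fun_prop)]
      simp
    _ ≤ ENNReal.ofReal (1 / (2 * w)) * ∑ _i : Fin n, ENNReal.ofReal v +
        ENNReal.ofReal (w / 2) := by gcongr with i; exact h4 i
    _ = ENNReal.ofReal w := by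
      rw [Finset.sum_const, Finset.card_univ, Fintype.card_fin, nsmul_eq_mul,
        ← ENNReal.ofReal_natCast, ← ENNReal.ofReal_mul hn'.le, ← hw2,
        ← ENNReal.ofReal_mul (by positivity), ← ENNReal.ofReal_add (by positivity) (by positivity)]
      congr 1
      field_simp
      ring

theorem lintegral_sampleDiscrepancy_le (h𝒢 : IsMeasurableClass 𝒢 G) {F : ℝ → ℝ}
    (hF : IsEnvelope F 𝒢) {J v : ℝ} (hJ : 0 ≤ J) (hv : 0 < v)
    (hent : uniformEntropyIntegral 𝒢 F ≤ ENNReal.ofReal J)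
    (hFv : ∫⁻ t, ENNReal.ofReal (F t ^ 2) ∂G ≤ ENNReal.ofReal v) (hn : n ≠ 0) :
    ∫⁻ p, sampleDiscrepancy 𝒢 p
        ∂((Measure.pi fun _ : Fin n => G).prod (Measure.pi fun _ : Fin n => G)) ≤
      ENNReal.ofReal (48 * (1 + 2 * J) * √(n * v)) := by
  set μ := Measure.pi fun _ : Fin n => G with hμ
  set D := ∫⁻ p, sampleDiscrepancy 𝒢 p ∂(μ.prod μ) with hD
  have hpow : ((2 : ℝ≥0∞) ^ n) ≠ 0 := by simp
  have hpow' : ((2 : ℝ≥0∞) ^ n) ≠ ∞ := by simp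
  refine (ENNReal.mul_le_mul_iff_right hpow hpow').1 ?_
  calc 2 ^ n * D = ∑ _s : Fin n → Bool, D := by simp
    _ ≤ ∑ s : Fin n → Bool, 2 * ∫⁻ x, ⨆ g ∈ 𝒢, ENNReal.ofReal |signedSum s fun i => g (x i)| ∂μ :=
        Finset.sum_le_sum fun s _ => lintegral_sampleDiscrepancy_le_signedSum h𝒢 s
    _ = 2 * ∫⁻ x, ∑ s : Fin n → Bool,
          ⨆ g ∈ 𝒢, ENNReal.ofReal |signedSum s fun i => g (x i)| ∂μ := by
        rw [← Finset.mul_sum, lintegral_finsetSum' _ fun s _ => aemeasurable_iSup_signedSum h𝒢 s]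
    _ ≤ 2 * ∫⁻ x : Fin n → ℝ, 2 ^ n * ENNReal.ofReal (24 * (1 + 2 * J)) *
          ENNReal.ofReal √(∑ i, F (x i) ^ 2) ∂μ := by
        gcongr with x
        refine (sum_iSup_signedSum_comp_le hn x hF.2 hJ hent).trans (le_of_eq ?_)
        rw [mul_assoc (2 ^ n), ← ENNReal.ofReal_mul (by positivity)]
        congr 2
        ring
    _ = 2 * (2 ^ n * ENNReal.ofReal (24 * (1 + 2 * J)) *
          ∫⁻ x : Fin n → ℝ, ENNReal.ofReal √(∑ i, F (x i) ^ 2) ∂μ) := by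
        have := hF.1
        rw [lintegral_const_mul _ (by fun_prop)]
    _ ≤ 2 * (2 ^ n * ENNReal.ofReal (24 * (1 + 2 * J)) * ENNReal.ofReal √(n * v)) := by
        gcongr
        exact lintegral_sqrt_sum_sq_le hF.1 hv hFv hn
    _ = 2 ^ n * ENNReal.ofReal (48 * (1 + 2 * J) * √(n * v)) := by
        rw [mul_assoc, ← ENNReal.ofReal_mul (by positivity), mul_left_comm,
          ← ENNReal.ofReal_ofNat 2, ← ENNReal.ofReal_mul (by positivity)]
        congr 2
        ring

theorem ofReal_abs_sum_sub_integral_le {g : ℝ → ℝ} (hg : g ∈ 𝒢) (hgi : Integrable g G)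
    (x : Fin n → ℝ) :
    ENNReal.ofReal |∑ i, g (x i) - n * ∫ t, g t ∂G| ≤
      ∫⁻ t, sampleDiscrepancy 𝒢 (x, t) ∂(Measure.pi fun _ : Fin n => G) := by
  set μ := Measure.pi fun _ : Fin n => G with hμ
  have hmp := fun i => measurePreserving_eval (fun _ : Fin n => G) i
  have hi : ∀ i : Fin n, Integrable (fun t : Fin n → ℝ => g (t i)) μ := fun i =>
    (hmp i).integrable_comp_of_integrable hgi
  have hint : ∀ i : Fin n, ∫ t : Fin n → ℝ, g (t i) ∂μ = ∫ t, g t ∂G := by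
    intro i
    have hae : AEStronglyMeasurable g (Measure.map (Function.eval i) μ) := by
      rw [(hmp i).map_eq]
      exact hgi.1
    have := integral_map (hmp i).measurable.aemeasurable hae
    rw [(hmp i).map_eq] at this
    exact this.symm
  have h1 : ∑ i, g (x i) - n * ∫ t, g t ∂G = ∫ t, (∑ i, g (x i) - ∑ i, g (t i)) ∂μ := by
    rw [integral_sub (integrable_const _) (integrable_finsetSum _ fun i _ => hi i),
      integral_finsetSum _ fun i _ => hi i]
    simp [hint]
  rw [h1, ← Real.norm_eq_abs, ofReal_norm]
  refine (enorm_integral_le_lintegral_enorm _).trans (lintegral_mono fun t => ?_)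
  rw [← ofReal_norm, Real.norm_eq_abs]
  exact le_iSup₂ (f := fun g (_ : g ∈ 𝒢) =>
    ENNReal.ofReal |∑ i, g (x i) - ∑ i, g (t i)|) g hg

theorem AEMeasurable.exists_measurable_ge_lintegral_eq {α : Type*} [MeasurableSpace α]
    {μ : Measure α} {f : α → ℝ≥0∞} (hf : AEMeasurable f μ) :
    ∃ u : α → ℝ≥0∞, Measurable u ∧ f ≤ u ∧ ∫⁻ x, u x ∂μ = ∫⁻ x, f x ∂μ := by
  classical
  set N := toMeasurable μ {x | f x ≠ hf.mk f x} with hN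
  have hN0 : μ N = 0 := by
    rw [hN, measure_toMeasurable]
    exact hf.ae_eq_mk
  refine ⟨N.piecewise (fun _ => ∞) (hf.mk f), Measurable.piecewise (measurableSet_toMeasurable _ _)
    measurable_const hf.measurable_mk, fun x => ?_, lintegral_congr_ae ?_⟩
  · by_cases hx : x ∈ N
    · simp [hx]
    · have h1 : ¬ f x ≠ hf.mk f x := fun h => hx (subset_toMeasurable _ _ h)
      simp [hx, ← not_not.1 h1]
  · have h1 : ∀ᵐ x ∂μ, x ∉ N := measure_eq_zero_iff_ae_notMem.1 hN0
    filter_upwards [h1, hf.ae_eq_mk] with x hx hx'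
    simp [hx, hx']

/-- The maximal inequality of empirical process theory under a uniform entropy integral, stated
for a measurable majorant of the supremum of the centred sums. -/
theorem exists_measurable_majorant_pi (h𝒢 : IsMeasurableClass 𝒢 G) {F : ℝ → ℝ}
    (hF : IsEnvelope F 𝒢) (hi : ∀ g ∈ 𝒢, Integrable g G) {J v : ℝ} (hJ : 0 ≤ J) (hv : 0 < v)
    (hent : uniformEntropyIntegral 𝒢 F ≤ ENNReal.ofReal J)
    (hFv : ∫⁻ t, ENNReal.ofReal (F t ^ 2) ∂G ≤ ENNReal.ofReal v) (hn : n ≠ 0) :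
    ∃ U : (Fin n → ℝ) → ℝ≥0∞, Measurable U ∧
      (∀ x, ∀ g ∈ 𝒢, ENNReal.ofReal |∑ i, g (x i) - n * ∫ t, g t ∂G| ≤ U x) ∧
      ∫⁻ x, U x ∂(Measure.pi fun _ : Fin n => G) ≤
        ENNReal.ofReal (48 * (1 + 2 * J) * √(n * v)) := by
  have hD := aemeasurable_sampleDiscrepancy (n := n) h𝒢
  obtain ⟨U, hU, hle, hUi⟩ := hD.lintegral_prod_right'.exists_measurable_ge_lintegral_eq
  refine ⟨U, hU, fun x g hg => (ofReal_abs_sum_sub_integral_le hg (hi g hg) x).trans (hle x), ?_⟩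
  rw [hUi, ← lintegral_prod _ hD]
  exact lintegral_sampleDiscrepancy_le h𝒢 hF hJ hv hent hFv hn

end Symmetrization

theorem abs_empiricalDeviation_le {Ω : Type*} {X : ℕ → Ω → ℝ} {G : Measure ℝ} {F g : ℝ → ℝ}
    (hF : Integrable F G) (hg : ∀ t, |g t| ≤ F t) (n : ℕ) (ω : Ω) :
    |empiricalDeviation X G n ω g| ≤
      (n : ℝ)⁻¹ * ∑ i ∈ Finset.range n, F (X i ω) + ∫ t, F t ∂G := by
  refine (abs_sub _ _).trans (add_le_add ?_ ?_)
  · rw [abs_mul, abs_of_nonneg (by positivity : (0 : ℝ) ≤ (n : ℝ)⁻¹)]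
    gcongr
    exact (Finset.abs_sum_le_sum_abs _ _).trans (Finset.sum_le_sum fun i _ => hg _)
  · exact norm_integral_le_of_norm_le (f := g) hF (Filter.Eventually.of_forall hg)

section Empirical

variable {Ω : Type*} [MeasurableSpace Ω] {P : Measure Ω} [IsProbabilityMeasure P]
  {G : Measure ℝ} {X : ℕ → Ω → ℝ}

theorem map_sample_eq_pi (hX_meas : ∀ i, Measurable (X i)) (hX_indep : iIndepFun X P)
    (hX_law : ∀ i, P.map (X i) = G) (n : ℕ) :
    P.map (fun ω (i : Fin n) => X i ω) = Measure.pi fun _ : Fin n => G := by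
  have h := (iIndepFun_iff_map_fun_eq_pi_map (f := fun (i : Fin n) => X i)
    fun i => (hX_meas i).aemeasurable).1 (hX_indep.precomp Fin.val_injective)
  simpa [hX_law] using h

variable [IsProbabilityMeasure G]

/-- Maximal inequality for the empirical process of an i.i.d. sample. -/
theorem exists_measurable_majorant_empiricalDeviation (hX_meas : ∀ i, Measurable (X i))
    (hX_indep : iIndepFun X P) (hX_law : ∀ i, P.map (X i) = G) {𝒢 : Set (ℝ → ℝ)}
    (h𝒢 : IsMeasurableClass 𝒢 G) {F : ℝ → ℝ} (hF : IsEnvelope F 𝒢)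
    (hi : ∀ g ∈ 𝒢, Integrable g G) {J v : ℝ} (hJ : 0 ≤ J) (hv : 0 < v)
    (hent : uniformEntropyIntegral 𝒢 F ≤ ENNReal.ofReal J)
    (hFv : ∫⁻ t, ENNReal.ofReal (F t ^ 2) ∂G ≤ ENNReal.ofReal v) {n : ℕ} (hn : n ≠ 0) :
    ∃ U : Ω → ℝ≥0∞, Measurable U ∧
      (∀ ω, ∀ g ∈ 𝒢, ENNReal.ofReal |empiricalDeviation X G n ω g| ≤ U ω) ∧
      ∫⁻ ω, U ω ∂P ≤ ENNReal.ofReal (48 * (1 + 2 * J) * √(v / n)) := by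
  have hn' : (0 : ℝ) < n := by positivity
  obtain ⟨U, hU, hle, hUi⟩ := exists_measurable_majorant_pi h𝒢 hF hi hJ hv hent hFv hn
  have hX : Measurable fun ω (i : Fin n) => X i ω := measurable_pi_lambda _ fun i => hX_meas i
  refine ⟨fun ω => ENNReal.ofReal (n : ℝ)⁻¹ * U fun i => X i ω, (hU.comp hX).const_mul _,
    fun ω g hg => ?_, ?_⟩
  · refine le_trans (le_of_eq ?_) (mul_le_mul_right (hle (fun i => X i ω) g hg) _)
    rw [← ENNReal.ofReal_mul (by positivity)]
    nth_rewrite 1 [← abs_of_pos (inv_pos.2 hn')]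
    rw [← abs_mul, mul_sub, empiricalDeviation, Finset.sum_range,
      inv_mul_cancel_left₀ hn'.ne']
  · beta_reduce
    have hUX : Measurable fun ω => U fun i => X i ω := hU.comp hX
    rw [lintegral_const_mul _ hUX, ← lintegral_map hU hX,
      map_sample_eq_pi hX_meas hX_indep hX_law]
    refine (mul_le_mul_right hUi _).trans (le_of_eq ?_)
    rw [← ENNReal.ofReal_mul (by positivity)]
    congr 1
    have h1 : √(n * v) = n * √(v / n) := by
      rw [← Real.sqrt_sq hn'.le, ← Real.sqrt_mul (by positivity), Real.sqrt_sq hn'.le]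
      congr 1
      field_simp
    rw [h1]
    field_simp

theorem integrable_of_lintegral_sq_le {F : ℝ → ℝ} (hF : Measurable F) {v : ℝ}
    (hFv : ∫⁻ t, ENNReal.ofReal (F t ^ 2) ∂G ≤ ENNReal.ofReal v) : Integrable F G := by
  have h2 : Integrable (fun t => F t ^ 2) G :=
    (lintegral_ofReal_ne_top_iff_integrable (by fun_prop)
      (Filter.Eventually.of_forall fun t => sq_nonneg _)).1 (hFv.trans_lt ENNReal.ofReal_lt_top).ne
  refine ((integrable_const (1 : ℝ)).add h2).mono' (by fun_prop)
    (Filter.Eventually.of_forall fun t => ?_)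
  simp only [Pi.add_apply, Real.norm_eq_abs]
  nlinarith [sq_nonneg (|F t| - 1), sq_abs (F t), abs_nonneg (F t)]

end Empirical

section Peeling

/-- Peeling: a process that is controlled by `U j` on the `j`-th shell is controlled everywhere, up
to `ε u ^ κ`, by a single random variable. -/
theorem exists_peeling_variable {Ω ι : Type*} [MeasurableSpace Ω] (P : Measure Ω) {κ ε p r : ℝ}
    (hκ : 0 ≤ κ) (hε : 0 < ε) (hp : 0 < p) (hr : 0 < r) (hpr : p * r ^ κ = 1)
    (D : ι → Ω → ℝ) (u : ι → ℝ) (hu : ∀ i, 0 ≤ u i) (U : ℕ → Ω → ℝ≥0∞)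
    (hU : ∀ j, Measurable (U j))
    (hDU : ∀ j : ℕ, ∀ ω i, u i ≤ (j + 1) * r → ENNReal.ofReal |D i ω| ≤ U j ω)
    (H : Ω → ℝ) (hH : Measurable H) (hDH : ∀ ω i, |D i ω| ≤ H ω) :
    ∃ M : Ω → ℝ, Measurable M ∧
      (∀ B : ℝ, 0 ≤ B → P {ω | B < |M ω|} ≤
        ∑' j : ℕ, P {ω | ENNReal.ofReal (B + ε * (j : ℝ) ^ κ) < ENNReal.ofReal p * U j ω}) ∧
      ∀ ω i, |D i ω| ≤ ε * u i ^ κ + p⁻¹ * M ω := by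
  set N : Ω → ℝ≥0∞ := fun ω => min (ENNReal.ofReal (p * H ω))
    (⨆ j : ℕ, (ENNReal.ofReal p * U j ω - ENNReal.ofReal (ε * (j : ℝ) ^ κ))) with hN
  have hNtop : ∀ ω, N ω ≠ ∞ := fun ω =>
    ((min_le_left _ _).trans_lt ENNReal.ofReal_lt_top).ne
  refine ⟨fun ω => (N ω).toReal, ?_, fun B hB => ?_, fun ω i => ?_⟩
  · refine Measurable.ennreal_toReal (Measurable.min (by fun_prop) (Measurable.iSup fun j => ?_))
    exact ((hU j).const_mul _).sub_const _
  · refine (measure_mono fun ω hω => ?_).trans (measure_iUnion_le _)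
    simp only [mem_ofPred_eq, abs_of_nonneg ENNReal.toReal_nonneg] at hω
    rw [← ENNReal.ofReal_lt_iff_lt_toReal hB (hNtop ω)] at hω
    obtain ⟨j, hj⟩ := lt_iSup_iff.1 (hω.trans_le (min_le_right _ _))
    refine mem_iUnion.2 ⟨j, ?_⟩
    rw [mem_ofPred_eq, ENNReal.ofReal_add hB (by positivity)]
    exact lt_tsub_iff_right.1 hj
  · set j := ⌊u i / r⌋₊ with hj
    have hj1 : (j : ℝ) * r ≤ u i := by
      rw [← le_div_iff₀ hr]
      exact Nat.floor_le (div_nonneg (hu i) hr.le)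
    have hj2 : u i ≤ (j + 1) * r := by
      rw [← div_le_iff₀ hr]
      exact (Nat.lt_floor_add_one _).le
    have hle : ENNReal.ofReal (p * |D i ω| - ε * (j : ℝ) ^ κ) ≤ N ω := by
      refine le_min (ENNReal.ofReal_le_ofReal ?_) (le_iSup_of_le j ?_)
      · have h1 : p * |D i ω| ≤ p * H ω := by gcongr; exact hDH ω i
        have h2 : 0 ≤ ε * (j : ℝ) ^ κ := by positivity
        linarith
      · rw [ENNReal.ofReal_sub _ (by positivity), ENNReal.ofReal_mul hp.le]
        gcongr
        exact hDU j ω i hj2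
    rw [ENNReal.ofReal_le_iff_le_toReal (hNtop ω)] at hle
    have h3 : (j : ℝ) ^ κ ≤ p * u i ^ κ := by
      calc (j : ℝ) ^ κ = p * ((j : ℝ) * r) ^ κ := by
            rw [Real.mul_rpow (by positivity) hr.le, mul_left_comm, hpr, mul_one]
        _ ≤ p * u i ^ κ := by gcongr
    have h4 : p * |D i ω| ≤ p * (ε * u i ^ κ + p⁻¹ * (N ω).toReal) := by
      rw [mul_add, mul_inv_cancel_left₀ hp.ne']
      nlinarith
    exact le_of_mul_le_mul_left h4 hp

theorem measure_lt_le_ofReal_div {Ω : Type*} [MeasurableSpace Ω] {P : Measure Ω} {V : Ω → ℝ≥0∞}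
    (hV : Measurable V) {b c : ℝ} (hb : 0 < b) (hVc : ∫⁻ ω, V ω ∂P ≤ ENNReal.ofReal c) :
    P {ω | ENNReal.ofReal b < V ω} ≤ ENNReal.ofReal (c / b) := by
  rw [ENNReal.ofReal_div_of_pos hb]
  have hsub : {ω | ENNReal.ofReal b < V ω} ⊆ {ω | ENNReal.ofReal b ≤ V ω} :=
    fun ω hω => by
      rw [mem_ofPred_eq] at hω ⊢
      exact hω.le
  refine (measure_mono hsub).trans
    ((meas_ge_le_lintegral_div hV.aemeasurable (ENNReal.ofReal_pos.2 hb).ne'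
      ENNReal.ofReal_ne_top).trans ?_)
  gcongr

theorem add_one_rpow_le {κ : ℝ} (hκ : 0 ≤ κ) (j : ℕ) :
    ((j : ℝ) + 1) ^ κ ≤ 2 ^ κ * (1 + (j : ℝ) ^ κ) := by
  rcases Nat.eq_zero_or_pos j with rfl | hj
  · have h1 : (1 : ℝ) ≤ 2 ^ κ := Real.one_le_rpow (by norm_num) hκ
    have h2 : (0 : ℝ) ≤ 0 ^ κ := by positivity
    simp only [Nat.cast_zero, zero_add, Real.one_rpow]
    nlinarith
  · have h1 : (1 : ℝ) ≤ j := by exact_mod_cast hj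
    calc ((j : ℝ) + 1) ^ κ ≤ (2 * j) ^ κ := by gcongr; linarith
      _ = 2 ^ κ * (j : ℝ) ^ κ := Real.mul_rpow (by norm_num) (by positivity)
      _ ≤ _ := by gcongr; linarith

theorem exists_peeling_level {C ε κ θ η : ℝ} (hC : 0 ≤ C) (hε : 0 < ε) (hκ : 0 ≤ κ)
    (hθ : θ + 1 < κ) (hη : 0 < η) :
    ∃ B : ℝ, 0 < B ∧
      ∑' j : ℕ, ENNReal.ofReal (C * ((j : ℝ) + 1) ^ θ / (B + ε * (j : ℝ) ^ κ)) ≤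
        ENNReal.ofReal η := by
  have hbound : ∀ B : ℝ, ε ≤ B → ∀ j : ℕ, C * ((j : ℝ) + 1) ^ θ / (B + ε * (j : ℝ) ^ κ) ≤
      C * ε⁻¹ * 2 ^ κ * ((j : ℝ) + 1) ^ (θ - κ) := by
    intro B hB j
    have hj : (0 : ℝ) < (j : ℝ) + 1 := by positivity
    have hB0 : 0 < B := hε.trans_le hB
    have hjκ : (0 : ℝ) ≤ (j : ℝ) ^ κ := by positivity
    rw [div_le_iff₀ (by positivity), Real.rpow_sub hj]
    have h1 := add_one_rpow_le hκ j
    have h2 : ε * (1 + (j : ℝ) ^ κ) ≤ B + ε * (j : ℝ) ^ κ := by linarith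
    have h3 : ((j : ℝ) + 1) ^ κ ≤ 2 ^ κ * (ε⁻¹ * (B + ε * (j : ℝ) ^ κ)) := by
      refine h1.trans ?_
      gcongr
      rw [← div_eq_inv_mul, le_div_iff₀ hε]
      linarith
    calc C * ((j : ℝ) + 1) ^ θ
        = C * (((j : ℝ) + 1) ^ θ / ((j : ℝ) + 1) ^ κ) * ((j : ℝ) + 1) ^ κ := by
          field_simp
      _ ≤ C * (((j : ℝ) + 1) ^ θ / ((j : ℝ) + 1) ^ κ) *
            (2 ^ κ * (ε⁻¹ * (B + ε * (j : ℝ) ^ κ))) := by gcongr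
      _ = _ := by ring
  have hsum : Summable fun j : ℕ => C * ε⁻¹ * 2 ^ κ * ((j : ℝ) + 1) ^ (θ - κ) := by
    refine Summable.mul_left _ ?_
    have h := (summable_nat_add_iff 1).2 (Real.summable_nat_rpow.2 (by linarith : θ - κ < -1))
    simpa using h
  have hnonneg : ∀ B : ℝ, ε ≤ B → ∀ j : ℕ,
      0 ≤ C * ((j : ℝ) + 1) ^ θ / (B + ε * (j : ℝ) ^ κ) := fun B hB j => by
    have hB0 : 0 < B := hε.trans_le hB
    positivity
  have hlim : Filter.Tendsto
      (fun B : ℝ => ∑' j : ℕ, C * ((j : ℝ) + 1) ^ θ / (B + ε * (j : ℝ) ^ κ)) Filter.atTop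
      (nhds (∑' _j : ℕ, (0 : ℝ))) := by
    refine tendsto_tsum_of_dominated_convergence hsum (fun j => ?_) ?_
    · exact tendsto_const_nhds.div_atTop
        (Filter.tendsto_atTop_add_const_right _ _ Filter.tendsto_id)
    · filter_upwards [Filter.eventually_ge_atTop ε] with B hB j
      rw [Real.norm_eq_abs, abs_of_nonneg (hnonneg B hB j)]
      exact hbound B hB j
  rw [tsum_zero] at hlim
  obtain ⟨B, hBη, hB⟩ := ((hlim.eventually_le_const hη).and
    (Filter.eventually_ge_atTop ε)).exists
  refine ⟨B, hε.trans_le hB, ?_⟩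
  rw [← ENNReal.ofReal_tsum_of_nonneg (hnonneg B hB)
    (Summable.of_nonneg_of_le (hnonneg B hB) (hbound B hB) hsum)]
  exact ENNReal.ofReal_le_ofReal hBη

end Peeling

theorem measurable_of_mem_localizedClass {𝓕 : Set (ℝ → ℝ)} {s : Set ℝ}
    (h𝓕 : ∀ f ∈ 𝓕, Measurable (s.indicator f)) {x R : ℝ} (hs : Icc x (x + R) ⊆ s) {g : ℝ → ℝ}
    (hg : g ∈ localizedClass 𝓕 x R) : Measurable g := by
  obtain ⟨f, hf, y, hy, rfl⟩ := hg
  have h : (Icc x y).indicator f = (Icc x y).indicator (s.indicator f) := by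
    rw [indicator_indicator, inter_eq_left.2 ((Icc_subset_Icc_right hy.2).trans hs)]
  rw [h]
  exact (h𝓕 f hf).indicator measurableSet_Icc

/-- The scaling identity behind the rate `n ^ (-(k + d) / (2 k + 1))`. -/
theorem rate_mul_sqrt_le {n : ℕ} (hn : 1 ≤ n) {k d K R c : ℝ} (hk : 0 ≤ k) (hd : 1 / 2 ≤ d)
    (hK : 0 < K) (hR : 0 < R) (hc : 0 < c)
    (hRc : R ≤ c * (n : ℝ) ^ (-(1 / (2 * k + 1)))) :
    (n : ℝ) ^ ((k + d) / (2 * k + 1)) * √(K * R ^ (2 * d - 1) / n) ≤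
      √K * c ^ (d - 1 / 2) := by
  have hn' : (0 : ℝ) < n := by exact_mod_cast hn
  have h2k : 0 < 2 * k + 1 := by positivity
  have h1 : R ^ (2 * d - 1) ≤ (c ^ (d - 1 / 2)) ^ 2 *
      (n : ℝ) ^ (-(1 / (2 * k + 1)) * (2 * d - 1)) := by
    refine (Real.rpow_le_rpow hR.le hRc (by linarith)).trans (le_of_eq ?_)
    rw [Real.mul_rpow hc.le (by positivity), ← Real.rpow_mul hn'.le, ← Real.rpow_mul_natCast hc.le]
    congr 2
    push_cast
    ring
  have h2 : ((n : ℝ) ^ ((k + d) / (2 * k + 1))) ^ 2 *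
      ((n : ℝ) ^ (-(1 / (2 * k + 1)) * (2 * d - 1)) / n) = 1 := by
    rw [← Real.rpow_mul_natCast hn'.le, ← Real.rpow_sub_one hn'.ne', ← Real.rpow_add hn']
    convert Real.rpow_zero (n : ℝ) using 2
    push_cast
    field_simp
    ring
  rw [← Real.sqrt_sq (by positivity : 0 ≤ (n : ℝ) ^ ((k + d) / (2 * k + 1))),
    ← Real.sqrt_mul (by positivity), ← Real.sqrt_sq (by positivity : 0 ≤ c ^ (d - 1 / 2)),
    ← Real.sqrt_mul hK.le]
  refine Real.sqrt_le_sqrt ?_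
  calc ((n : ℝ) ^ ((k + d) / (2 * k + 1))) ^ 2 * (K * R ^ (2 * d - 1) / n)
      ≤ ((n : ℝ) ^ ((k + d) / (2 * k + 1))) ^ 2 * (K * ((c ^ (d - 1 / 2)) ^ 2 *
        (n : ℝ) ^ (-(1 / (2 * k + 1)) * (2 * d - 1))) / n) := by gcongr
    _ = K * (c ^ (d - 1 / 2)) ^ 2 * (((n : ℝ) ^ ((k + d) / (2 * k + 1))) ^ 2 *
      ((n : ℝ) ^ (-(1 / (2 * k + 1)) * (2 * d - 1)) / n)) := by ring
    _ = K * (c ^ (d - 1 / 2)) ^ 2 := by rw [h2, mul_one]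

theorem lemmaA1 {Ω : Type*} [MeasurableSpace Ω] (P : Measure Ω) [IsProbabilityMeasure P]
    -- the observations: independent, with common distribution `G₀`
    (G₀ : Measure ℝ) [IsProbabilityMeasure G₀] (X : ℕ → Ω → ℝ)
    (hX_meas : ∀ i, Measurable (X i)) (hX_indep : iIndepFun X P)
    (hX_law : ∀ i, P.map (X i) = G₀)
    (k : ℕ) (hk : 1 ≤ k) (d : ℝ) (hd : 1 / 2 ≤ d)
    -- the class of functions on `[x₀ - δ, x₀ + δ]`; values off that interval play no role
    (x₀ δ : ℝ) (hδ : 0 < δ) (𝓕 : Set (ℝ → ℝ))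
    (h𝓕 : ∀ f ∈ 𝓕, Measurable ((Icc (x₀ - δ) (x₀ + δ)).indicator f))
    (x : ℝ) (hx : x ∈ Ico (x₀ - δ) (x₀ + δ)) (R₀ : ℝ) (hR₀ : 0 < R₀)
    (h_class : ∀ R ∈ admissibleScales x₀ δ R₀ x, IsMeasurableClass (localizedClass 𝓕 x R) G₀)
    -- `F R` is the envelope of the localized class at scale `R`
    (F : ℝ → ℝ → ℝ)
    (hF_env : ∀ R ∈ admissibleScales x₀ δ R₀ x, IsEnvelope (F R) (localizedClass 𝓕 x R))
    (K : ℝ) (hK : 0 < K)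
    (hF_moment : ∀ R ∈ admissibleScales x₀ δ R₀ x,
      ∫⁻ t, ENNReal.ofReal (F R t ^ 2) ∂G₀ ≤ ENNReal.ofReal (K * R ^ (2 * d - 1)))
    (h_entropy : (⨆ R ∈ admissibleScales x₀ δ R₀ x,
      uniformEntropyIntegral (localizedClass 𝓕 x R) (F R)) < ∞) :
    ∀ ε : ℝ, 0 < ε → ∃ M : ℕ → Ω → ℝ,
      (∀ n, Measurable (M n)) ∧ IsBigOpOne P M ∧
      ∀ n : ℕ, 1 ≤ n → ∀ ω, ∀ f ∈ 𝓕, ∀ y ∈ Icc x (x₀ + δ), |y - x| ≤ R₀ →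
        |empiricalDeviation X G₀ n ω ((Icc x y).indicator f)| ≤
          ε * |y - x| ^ ((k : ℝ) + d)
            + (n : ℝ) ^ (-(((k : ℝ) + d) / (2 * (k : ℝ) + 1))) * M n ω := by
  intro ε hε
  set κ : ℝ := k + d with hκ
  have hk' : (1 : ℝ) ≤ k := by exact_mod_cast hk
  have hκ0 : 0 ≤ κ := by linarith
  have h2k : (0 : ℝ) < 2 * k + 1 := by positivity
  set J := (⨆ R ∈ admissibleScales x₀ δ R₀ x,
    uniformEntropyIntegral (localizedClass 𝓕 x R) (F R)).toReal with hJdef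
  have hJ : 0 ≤ J := ENNReal.toReal_nonneg
  have hent : ∀ R ∈ admissibleScales x₀ δ R₀ x,
      uniformEntropyIntegral (localizedClass 𝓕 x R) (F R) ≤ ENNReal.ofReal J := by
    intro R hR
    rw [hJdef, ENNReal.ofReal_toReal h_entropy.ne]
    exact le_iSup₂ (f := fun R (_ : R ∈ admissibleScales x₀ δ R₀ x) =>
      uniformEntropyIntegral (localizedClass 𝓕 x R) (F R)) R hR
  set Rmax := min R₀ (x₀ + δ - x) with hRmax
  have hRmax0 : 0 < Rmax := lt_min hR₀ (by linarith [hx.2])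
  have hadm : ∀ R, 0 < R → R ≤ Rmax → R ∈ admissibleScales x₀ δ R₀ x := fun R h0 hR =>
    ⟨h0, hR.trans (min_le_left _ _), Icc_subset_Icc hx.1
      (by linarith [hR.trans (min_le_right _ _)])⟩
  have hFint : ∀ R ∈ admissibleScales x₀ δ R₀ x, Integrable (F R) G₀ := fun R hR =>
    integrable_of_lintegral_sq_le (hF_env R hR).1 (hF_moment R hR)
  have hgint : ∀ R ∈ admissibleScales x₀ δ R₀ x, ∀ g ∈ localizedClass 𝓕 x R,
      Integrable g G₀ := fun R hR g hg =>
    (hFint R hR).mono' (measurable_of_mem_localizedClass h𝓕 hR.2.2 hg).aestronglyMeasurable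
      (Filter.Eventually.of_forall ((hF_env R hR).2 g hg))
  set C := 48 * (1 + 2 * J) * √K with hC
  have main : ∀ n : ℕ, ∃ M : Ω → ℝ, Measurable M ∧ (1 ≤ n →
      (∀ B : ℝ, 0 < B → P {ω | B < |M ω|} ≤ ∑' j : ℕ, ENNReal.ofReal
        (C * ((j : ℝ) + 1) ^ (d - 1 / 2) / (B + ε * (j : ℝ) ^ κ))) ∧
      ∀ ω, ∀ f ∈ 𝓕, ∀ y ∈ Icc x (x + Rmax),
        |empiricalDeviation X G₀ n ω ((Icc x y).indicator f)| ≤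
          ε * (y - x) ^ κ + (n : ℝ) ^ (-(κ / (2 * (k : ℝ) + 1))) * M ω) := by
    intro n
    rcases Nat.eq_zero_or_pos n with rfl | hn
    · exact ⟨0, measurable_zero, fun h => absurd h (by norm_num)⟩
    have hn' : (0 : ℝ) < n := by exact_mod_cast hn
    set r : ℝ := (n : ℝ) ^ (-(1 / (2 * (k : ℝ) + 1))) with hr
    set p : ℝ := (n : ℝ) ^ (κ / (2 * (k : ℝ) + 1)) with hp
    have hr0 : 0 < r := by positivity
    have hp0 : 0 < p := by positivity
    have hpr : p * r ^ κ = 1 := by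
      rw [hp, hr, ← Real.rpow_mul hn'.le, ← Real.rpow_add hn']
      convert Real.rpow_zero (n : ℝ) using 2
      field_simp
      ring
    set R : ℕ → ℝ := fun j => min (((j : ℝ) + 1) * r) Rmax with hRdef
    have hR0 : ∀ j, 0 < R j := fun j => lt_min (by positivity) hRmax0
    have hRadm : ∀ j, R j ∈ admissibleScales x₀ δ R₀ x := fun j =>
      hadm _ (hR0 j) (min_le_right _ _)
    choose U hU hDU hUi using fun j => exists_measurable_majorant_empiricalDeviation hX_meas
      hX_indep hX_law (h_class _ (hRadm j)) (hF_env _ (hRadm j)) (hgint _ (hRadm j)) hJ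
      (by have := hR0 j; positivity : 0 < K * R j ^ (2 * d - 1)) (hent _ (hRadm j))
      (hF_moment _ (hRadm j)) hn.ne'
    have hmaxadm := hadm Rmax hRmax0 le_rfl
    obtain ⟨M, hM, hMB, hMD⟩ := exists_peeling_variable
      (ι := {q : (ℝ → ℝ) × ℝ // q.1 ∈ 𝓕 ∧ q.2 ∈ Icc x (x + Rmax)}) P hκ0 hε hp0 hr0 hpr
      (fun q ω => empiricalDeviation X G₀ n ω ((Icc x q.1.2).indicator q.1.1))
      (fun q => q.1.2 - x) (fun q => sub_nonneg.2 q.2.2.1) U hU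
      (fun j ω q hq => hDU j ω _ ⟨q.1.1, q.2.1, q.1.2, ⟨q.2.2.1, by
        have h1 : q.1.2 - x ≤ R j := le_min hq (by linarith [q.2.2.2])
        linarith⟩, rfl⟩)
      (fun ω => (n : ℝ)⁻¹ * ∑ i ∈ Finset.range n, F Rmax (X i ω) + ∫ t, F Rmax t ∂G₀)
      (((Finset.measurable_sum _ fun i _ =>
        (hF_env _ hmaxadm).1.comp (hX_meas i)).const_mul _).add_const _)
      (fun ω q => abs_empiricalDeviation_le (hFint _ hmaxadm)
        ((hF_env _ hmaxadm).2 _ ⟨q.1.1, q.2.1, q.1.2, q.2.2, rfl⟩) n ω)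
    refine ⟨M, hM, fun _ => ⟨fun B hB => (hMB B hB.le).trans (ENNReal.tsum_le_tsum fun j => ?_),
      fun ω f hf y hy => ?_⟩⟩
    · refine measure_lt_le_ofReal_div ((hU j).const_mul _) (by positivity) ?_
      rw [lintegral_const_mul _ (hU j)]
      refine (mul_le_mul_right (hUi j) _).trans ?_
      rw [← ENNReal.ofReal_mul hp0.le]
      refine ENNReal.ofReal_le_ofReal ?_
      have h1 := rate_mul_sqrt_le hn (c := (j : ℝ) + 1) (by positivity : (0 : ℝ) ≤ k) hd hK (hR0 j)
        (by positivity) (min_le_left _ _)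
      calc p * (48 * (1 + 2 * J) * √(K * R j ^ (2 * d - 1) / n))
          = 48 * (1 + 2 * J) * (p * √(K * R j ^ (2 * d - 1) / n)) := by ring
        _ ≤ 48 * (1 + 2 * J) * (√K * ((j : ℝ) + 1) ^ (d - 1 / 2)) := by gcongr
        _ = C * ((j : ℝ) + 1) ^ (d - 1 / 2) := by ring
    · have h1 := hMD ω ⟨(f, y), hf, hy⟩
      rwa [hp, ← Real.rpow_neg hn'.le] at h1
  choose M hM hMn using main
  refine ⟨M, hM, fun η hη => ?_, fun n hn ω f hf y hy hyR => ?_⟩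
  · obtain ⟨B, hB, hBη⟩ := exists_peeling_level (C := C) (θ := d - 1 / 2) (by positivity) hε hκ0
      (by linarith) hη
    exact ⟨B, fun n hn => ((hMn n hn).1 B hB).trans hBη⟩
  · have hyx : 0 ≤ y - x := sub_nonneg.2 hy.1
    rw [abs_of_nonneg hyx] at hyR ⊢
    refine (hMn n hn).2 ω f hf y ⟨hy.1, ?_⟩
    linarith [le_min hyR (by linarith [hy.2] : y - x ≤ x₀ + δ - x)]
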